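/- Let $k$ be a field and let $R=k\{x_1,\dots,x_n;Q,\preceq\}$ be a PBW algebra. That is, $\preceq$ is an admissible order on $\mathbb N^n$, the standard monomials $x^\alpha=x_1^{\alpha_1}\cdots x_n^{\alpha_n}$ ($\alpha\in\mathbb N^n$) form a $k$-basis of $R$, and $R$ is the quotient of $k\langle x_1,\dots,x_n\rangle$ by the two-sided ideal generated by a set $Q=\{x_jx_i-q_{ji}x_ix_j-p_{ji}: 1\le i<j\le n\}$, where $q_{ji}\in k^*$ and $p_{ji}$ is a $k$-linear combination of standard monomials $x^\alpha$ with $\alpha\prec\epsilon_i+\epsilon_j$. Let $R^{\rm env}=R\otimes_k R^{\rm op}$, with its $k$-basis of standard monomials $x^\alpha\otimes x^{\beta^{\rm op}}$ of exponents $(\alpha,\beta)\in\mathbb N^{2n}$, where $\beta^{\rm op}=(\beta_n,\dots,\beta_1)$. The algebra $R^{\rm env}$ acts on $R^s$ by $(r\otimes r')f=rfr'$ componentwise; $R$-subbimodules are the same as left $R^{\rm env}$-submodules. Put $\mathfrak m^s:(R^{\rm env})^s\to R^s$, $(f_i\otimes g_i)_i\mapsto(f_ig_i)_i$, and $f\otimes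 1=(f_1\otimes1,\dots,f_s\otimes1)$ for $f\in R^s$. For a matrix $F\in M_{t\times q}(R)$ with rows $f_1,\dots,f_t$ and $h\in(R^{\rm env})^t$ put $hF=\sum_i h_if_i\in R^q$, and $Syz(F)=\{h\in(R^{\rm env})^t: hF=0\}$. On $\mathbb N^{2n}$ consider the strict orders comparing $(\alpha,\beta)$ with $(\gamma,\delta)$ as follows. - $\prec^*$: $\beta^{\rm op}\prec\delta^{\rm op}$, or $\beta=\delta$ and $\alpha\prec\gamma$. - $\prec_*$: $\alpha\prec\gamma$, or $\alpha=\gamma$ and $\beta^{\rm op}\prec\delta^{\rm op}$. - $\prec^c$: $\alpha+\beta^{\rm op}\prec\gamma+\delta^{\rm op}$, or equality of these sums and $\beta^{\rm op}\prec\delta^{\rm op}$. - $\prec_c$: $\alpha+\beta^{\rm op}\prec\gamma+\delta^{\rm op}$, or equality of these sums and $\alpha\prec\gamma$. Given an order on exponents, POT is the order on pairs (exponent, position) with $(\alpha,i)\prec(\beta,j)$ iff $i>j$, or $i=j$ and $\alpha\prec\beta$. Write $\exp(f)$ for the exponent of the leading term of $f\neq0$, and ${\rm Exp}(N)=\{\exp(f):0\ne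 f\in N\}$. A finite set $G\subseteq N\setminus\{0\}$ is a left Gröbner basis of a left submodule $N$ if ${\rm Exp}(N)=\bigcup_{g\in G}(E+\exp(g))$, where $E$ is the monoid of exponents ($\mathbb N^n$ for $R$, $\mathbb N^{2n}$ for $R^{\rm env}$). A finite set $G\subseteq M\setminus\{0\}$ is a two-sided Gröbner basis of a subbimodule $M\subseteq R^s$ if $M={}_R\langle G\rangle_R$ and ${\rm Exp}(M)=\bigcup_{g\in G}(\mathbb N^n+\exp(g))$. **Lemma.** Let $s,p,q\ge1$, let $M$ be an $R$-subbimodule of $R^s$, let $H_1\in M_{s\times q}(R)$, $H_2\in M_{p\times q}(R)$ and $H=\left[\begin{smallmatrix}H_1\\H_2\end{smallmatrix}\right]\in M_{(s+p)\times q}(R)$, and suppose that (i) $(\mathfrak m^s(h)\otimes 1)H_1=hH_1$ for all $h\in(R^{\rm env})^s$; (ii) $M=\{h\in R^s:\ \exists\,h''\in(R^{\rm env})^p \text{ such that } (h\otimes1,h'')\in Syz(H)\}$. Write $h=(h',h'')$ with $h'\in(R^{\rm env})^s$ and $h''\in(R^{\rm env})^p$ for $h\in(R^{\rm env})^{s+p}$,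 and let $h_1,\dots,h_t\in(R^{\rm env})^{s+p}$. 1. If $\{h_1,\dots,h_t\}$ generates $Syz(H)$ as an $R$-bimodule, then $M={}_R\langle\mathfrak m^s(h_1'),\dots,\mathfrak m^s(h_t')\rangle_R$. 2. If $\{h_1,\dots,h_t\}$ is a left Gröbner basis of the left $R^{\rm env}$-module $Syz(H)$ for the order POT on $(R^{\rm env})^{s+p}$ attached to any one of $\prec^*,\prec^c,\prec_*,\prec_c$, then $\{\mathfrak m^s(h_1'),\dots,\mathfrak m^s(h_t')\}\setminus\{0\}$ is a two-sided Gröbner basis of $M$ for the order POT on $R^s$ attached to $\prec$. -/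

import Mathlib

open scoped TensorProduct MonomialOrder

noncomputable section

namespace PBW

/-- The standard monomial `x^α = x_1^{α_1} ⋯ x_n^{α_n}` (factors in this order). -/
def stdMonomial {A : Type*} [Monoid A] {n : ℕ} (x : Fin n → A) (α : Fin n →₀ ℕ) : A :=
  (List.ofFn fun i => x i ^ α i).prod

/-- The set of quantum relations `x_j x_i - q_{ji} x_i x_j - p_{ji}`, `i < j`, in the free algebra,
where `p_{ji}` is the linear combination of standard monomials with coefficients `p j i`. -/
def quantumRelations {k : Type*} [Field k] {n : ℕ} (q : Fin n → Fin n → k)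
    (p : Fin n → Fin n → ((Fin n →₀ ℕ) →₀ k)) : Set (FreeAlgebra k (Fin n)) :=
  {f | ∃ i j : Fin n, i < j ∧
    f = FreeAlgebra.ι k j * FreeAlgebra.ι k i - q j i • (FreeAlgebra.ι k i * FreeAlgebra.ι k j)
      - (p j i).sum fun α c => c • stdMonomial (FreeAlgebra.ι k) α}

/-- `R = k{x_1, …, x_n; Q, ≼}` is a PBW algebra on the generators `x`, for the admissible
order `m` on `ℕ^n`: the standard monomials are a `k`-basis of `R`, and `R` is the quotient of the
free algebra by the two-sided ideal generated by a set of quantum relations bounded by `m`. -/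
structure IsPBWAlgebra (k : Type*) {R : Type*} [Field k] [Ring R] [Algebra k R] {n : ℕ}
    (m : MonomialOrder (Fin n)) (x : Fin n → R) : Prop where
  linearIndependent : LinearIndependent k (stdMonomial x)
  span_eq_top : Submodule.span k (Set.range (stdMonomial x)) = ⊤
  surjective : Function.Surjective (FreeAlgebra.lift k x)
  exists_relations : ∃ (q : Fin n → Fin n → k) (p : Fin n → Fin n → ((Fin n →₀ ℕ) →₀ k)),
    (∀ i j : Fin n, i < j → q j i ≠ 0) ∧
    (∀ i j : Fin n, i < j → ∀ α ∈ (p j i).support,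
      α ≺[m] Finsupp.single i 1 + Finsupp.single j 1) ∧
    TwoSidedIdeal.ker (FreeAlgebra.lift k x) = TwoSidedIdeal.span (quantumRelations q p)

/-- The basis of standard monomials of a PBW algebra. -/
def IsPBWAlgebra.basis {k R : Type*} [Field k] [Ring R] [Algebra k R] {n : ℕ}
    {m : MonomialOrder (Fin n)} {x : Fin n → R} (hR : IsPBWAlgebra k m x) :
    Module.Basis (Fin n →₀ ℕ) k R :=
  Module.Basis.mk hR.linearIndependent hR.span_eq_top.ge

theorem IsPBWAlgebra.basis_apply {k R : Type*} [Field k] [Ring R] [Algebra k R] {n : ℕ}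
    {m : MonomialOrder (Fin n)} {x : Fin n → R} (hR : IsPBWAlgebra k m x) (α : Fin n →₀ ℕ) :
    hR.basis α = stdMonomial x α := by
  simp [IsPBWAlgebra.basis]

/-! ### The enveloping algebra -/

/-- The enveloping algebra `R ⊗_k R^op`. -/
abbrev Env (k R : Type*) [Field k] [Ring R] [Algebra k R] : Type _ := R ⊗[k] Rᵐᵒᵖ

/-- `R` as a left module over its enveloping algebra, `(r ⊗ r') f = r f r'`. The induced
componentwise structure on `R^s` identifies the `R`-subbimodules of `R^s` with the
left `R ⊗ R^op`-submodules, and bimodule generation with generation over `R ⊗ R^op`. -/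
instance envModule (k R : Type*) [Field k] [Ring R] [Algebra k R] : Module (Env k R) R :=
  TensorProduct.Algebra.module

theorem env_tmul_smul {k R : Type*} [Field k] [Ring R] [Algebra k R] (r r' f : R) :
    (r ⊗ₜ[k] MulOpposite.op r' : Env k R) • f = r * f * r' := by
  rw [TensorProduct.Algebra.smul_def]
  simp [mul_assoc]

/-- The multiplication map `𝔪 : R ⊗ R^op → R`, `r ⊗ r' ↦ r r'`. -/
def mulEnv (k R : Type*) [Field k] [Ring R] [Algebra k R] : Env k R →ₗ[k] R :=
  LinearMap.mul' k R ∘ₗ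
    TensorProduct.map LinearMap.id (MulOpposite.opLinearEquiv k).symm.toLinearMap

theorem mulEnv_tmul {k R : Type*} [Field k] [Ring R] [Algebra k R] (r r' : R) :
    mulEnv k R (r ⊗ₜ[k] MulOpposite.op r') = r * r' := by
  simp [mulEnv]

/-- The map `𝔪^s : (R ⊗ R^op)^s → R^s`. -/
def mulEnvPow {k R : Type*} [Field k] [Ring R] [Algebra k R] {s : ℕ} (h : Fin s → Env k R) :
    Fin s → R :=
  fun i => mulEnv k R (h i)

/-- The element `f ⊗ 1 = (f_1 ⊗ 1, …, f_s ⊗ 1)` of `(R ⊗ R^op)^s`. -/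
def tmulOne (k : Type*) {R : Type*} [Field k] [Ring R] [Algebra k R] {s : ℕ} (f : Fin s → R) :
    Fin s → Env k R :=
  fun i => f i ⊗ₜ[k] 1

/-- The product `h F = ∑ h_i f_i ∈ R^q` of `h ∈ (R ⊗ R^op)^t` with the matrix `F` over `R` whose
rows are `f_1, …, f_t`, as a homomorphism of left `R ⊗ R^op`-modules in `h`. -/
def envVecMul (k : Type*) {R : Type*} [Field k] [Ring R] [Algebra k R] {t q : ℕ}
    (F : Matrix (Fin t) (Fin q) R) : (Fin t → Env k R) →ₗ[Env k R] (Fin q → R) where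
  toFun h := ∑ i, h i • F.row i
  map_add' h h' := by simp [add_smul, Finset.sum_add_distrib]
  map_smul' a h := by
    simp only [Pi.smul_apply, smul_eq_mul, RingHom.id_apply, Finset.smul_sum]
    exact Finset.sum_congr rfl fun i _ => mul_smul a (h i) (F.row i)

/-- The syzygy bimodule `Syz(F)`. -/
def syz (k : Type*) {R : Type*} [Field k] [Ring R] [Algebra k R] {t q : ℕ}
    (F : Matrix (Fin t) (Fin q) R) : Submodule (Env k R) (Fin t → Env k R) :=
  LinearMap.ker (envVecMul k F)

/-- The exponent `α^op = (α_n, …, α_1)`. -/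
def opExp {n : ℕ} : (Fin n →₀ ℕ) ≃ (Fin n →₀ ℕ) :=
  Finsupp.equivCongrLeft Fin.revPerm

theorem opExp_apply {n : ℕ} (α : Fin n →₀ ℕ) (i : Fin n) : opExp α i = α i.rev := by
  simp [opExp]

/-- The basis of standard monomials of `R ⊗ R^op`, as a PBW algebra in the variables
`x_1 ⊗ 1, …, x_n ⊗ 1, 1 ⊗ x_n, …, 1 ⊗ x_1`: the one of exponent `(α, β)` is `x^α ⊗ x^{β^op}`. -/
def IsPBWAlgebra.envBasis {k R : Type*} [Field k] [Ring R] [Algebra k R] {n : ℕ}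
    {m : MonomialOrder (Fin n)} {x : Fin n → R} (hR : IsPBWAlgebra k m x) :
    Module.Basis ((Fin n →₀ ℕ) × (Fin n →₀ ℕ)) k (Env k R) :=
  hR.basis.tensorProduct
    ((hR.basis.map (MulOpposite.opLinearEquiv k)).reindex opExp)

theorem IsPBWAlgebra.envBasis_apply {k R : Type*} [Field k] [Ring R] [Algebra k R] {n : ℕ}
    {m : MonomialOrder (Fin n)} {x : Fin n → R} (hR : IsPBWAlgebra k m x)
    (α β : Fin n →₀ ℕ) :
    hR.envBasis (α, β) =
      stdMonomial x α ⊗ₜ[k] MulOpposite.op (stdMonomial x (opExp β)) := by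
  have h : (opExp (n := n)).symm β = opExp β := by
    rw [Equiv.symm_apply_eq]; ext i; simp [opExp_apply]
  simp [IsPBWAlgebra.envBasis, IsPBWAlgebra.basis_apply, h]

/-- In `R ⊗ R^op` the standard monomial of exponent `(α, β)` is the ordered product
`(x_1 ⊗ 1)^{α_1} ⋯ (x_n ⊗ 1)^{α_n} (1 ⊗ x_n)^{β_1} ⋯ (1 ⊗ x_1)^{β_n}`. -/
theorem IsPBWAlgebra.envBasis_apply' {k R : Type*} [Field k] [Ring R] [Algebra k R] {n : ℕ}
    {m : MonomialOrder (Fin n)} {x : Fin n → R} (hR : IsPBWAlgebra k m x)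
    (α β : Fin n →₀ ℕ) :
    hR.envBasis (α, β) =
      stdMonomial (fun i => (x i ⊗ₜ[k] 1 : Env k R)) α *
        stdMonomial (fun i => (1 ⊗ₜ[k] MulOpposite.op (x i.rev) : Env k R)) β := by
  have h₁ : stdMonomial (fun i => (x i ⊗ₜ[k] 1 : Env k R)) α = stdMonomial x α ⊗ₜ[k] 1 := by
    have := map_list_prod (Algebra.TensorProduct.includeLeft : R →ₐ[k] Env k R)
      (List.ofFn fun i => x i ^ α i)
    simp only [Algebra.TensorProduct.includeLeft_apply, List.map_ofFn] at this
    rw [stdMonomial, stdMonomial, this]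
    congr 2
    funext i
    simp [Algebra.TensorProduct.tmul_pow]
  have h₂ : stdMonomial (fun i => (1 ⊗ₜ[k] MulOpposite.op (x i.rev) : Env k R)) β =
      1 ⊗ₜ[k] MulOpposite.op (stdMonomial x (opExp β)) := by
    have := map_list_prod (Algebra.TensorProduct.includeRight : Rᵐᵒᵖ →ₐ[k] Env k R)
      ((List.ofFn fun i => x i ^ opExp β i).map MulOpposite.op).reverse
    rw [← MulOpposite.op_list_prod] at this
    simp only [Algebra.TensorProduct.includeRight_apply] at this
    rw [stdMonomial, stdMonomial, this]
    congr 1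
    apply List.ext_getElem
    · simp
    · intro i hi _
      have hi' : i < n := by simpa using hi
      have hr : (⟨n - 1 - i, by omega⟩ : Fin n) = Fin.rev ⟨i, hi'⟩ := by
        ext; simp [Fin.rev]; omega
      simp [Algebra.TensorProduct.tmul_pow, opExp_apply, hr]
  rw [envBasis_apply, h₁, h₂]
  simp

/-! ### Orders on exponents -/

/-- The strict order `≺^op` on `ℕ^n`: `β ≺^op δ ↔ β^op ≺ δ^op`. -/
def opLT {n : ℕ} (m : MonomialOrder (Fin n)) (β δ : Fin n →₀ ℕ) : Prop :=
  opExp β ≺[m] opExp δ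

/-- The elimination order `≺^*` on `ℕ^{2n}`: compare the second components for `≺^op`, then the
first ones for `≺`. -/
def elimUp {n : ℕ} (m : MonomialOrder (Fin n)) (a b : (Fin n →₀ ℕ) × (Fin n →₀ ℕ)) : Prop :=
  opLT m a.2 b.2 ∨ (a.2 = b.2 ∧ a.1 ≺[m] b.1)

/-- The elimination order `≺_*` on `ℕ^{2n}`: compare the first components for `≺`, then the
second ones for `≺^op`. -/
def elimDown {n : ℕ} (m : MonomialOrder (Fin n)) (a b : (Fin n →₀ ℕ) × (Fin n →₀ ℕ)) : Prop :=
  a.1 ≺[m] b.1 ∨ (a.1 = b.1 ∧ opLT m a.2 b.2)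

/-- The up-component composition order `≺^c` on `ℕ^{2n}`. -/
def compUp {n : ℕ} (m : MonomialOrder (Fin n)) (a b : (Fin n →₀ ℕ) × (Fin n →₀ ℕ)) : Prop :=
  a.1 + opExp a.2 ≺[m] b.1 + opExp b.2 ∨
    (a.1 + opExp a.2 = b.1 + opExp b.2 ∧ opExp a.2 ≺[m] opExp b.2)

/-- The down-component composition order `≺_c` on `ℕ^{2n}`. -/
def compDown {n : ℕ} (m : MonomialOrder (Fin n)) (a b : (Fin n →₀ ℕ) × (Fin n →₀ ℕ)) : Prop :=
  a.1 + opExp a.2 ≺[m] b.1 + opExp b.2 ∨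
    (a.1 + opExp a.2 = b.1 + opExp b.2 ∧ a.1 ≺[m] b.1)

/-- The order POT (position over term) attached to a strict order on exponents; the first
position is the largest. -/
def pot {E : Type*} (lt : E → E → Prop) {s : ℕ} (a b : E × Fin s) : Prop :=
  b.2 < a.2 ∨ (a.2 = b.2 ∧ lt a.1 b.1)

/-! ### Gröbner bases

`A` is an algebra with a basis `B` of standard monomials with exponents in `E`, and `lt` is a
strict order on the exponents `E × {1, …, s}` of the elements of `A^s`. -/

/-- `exp(f) = e`: the exponent of the leading term of `f` is `e` (never true for `f = 0`). -/
def IsExp {k A E : Type*} [Field k] [Ring A] [Algebra k A] (B : Module.Basis E k A) {s : ℕ}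
    (lt : E × Fin s → E × Fin s → Prop) (f : Fin s → A) (e : E × Fin s) : Prop :=
  B.repr (f e.2) e.1 ≠ 0 ∧ ∀ e', B.repr (f e'.2) e'.1 ≠ 0 → e' = e ∨ lt e' e

/-- `Exp(M)`: the set of all `exp(f)`, where `f` runs over the nonzero elements of `M`. -/
def expSet {k A E : Type*} [Field k] [Ring A] [Algebra k A] (B : Module.Basis E k A) {s : ℕ}
    (lt : E × Fin s → E × Fin s → Prop) (M : Set (Fin s → A)) : Set (E × Fin s) :=
  {e | ∃ f ∈ M, IsExp B lt f e}

/-- The union over `g ∈ G` of the sets `E + exp(g)`. -/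
def expTranslates {k A E : Type*} [Field k] [Ring A] [Algebra k A] [Add E]
    (B : Module.Basis E k A) {s : ℕ}
    (lt : E × Fin s → E × Fin s → Prop) (G : Set (Fin s → A)) : Set (E × Fin s) :=
  {e | ∃ g ∈ G, ∃ d, IsExp B lt g d ∧ ∃ γ, e = (γ + d.1, d.2)}

/-- `G` is a left Gröbner basis of the left submodule `M` of `A^s`. -/
structure IsLeftGroebnerBasis {k A E : Type*} [Field k] [Ring A] [Algebra k A] [Add E]
    (B : Module.Basis E k A) {s : ℕ} (lt : E × Fin s → E × Fin s → Prop)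
    (M : Submodule A (Fin s → A)) (G : Set (Fin s → A)) : Prop where
  finite : G.Finite
  subset : G ⊆ (M : Set (Fin s → A)) \ {0}
  expSet_eq : expSet B lt (M : Set (Fin s → A)) = expTranslates B lt G

/-- `G` is a two-sided Gröbner basis of the `R`-subbimodule `M` of `R^s`. -/
structure IsTwoSidedGroebnerBasis {k R E : Type*} [Field k] [Ring R] [Algebra k R] [Add E]
    (B : Module.Basis E k R) {s : ℕ} (lt : E × Fin s → E × Fin s → Prop)
    (M : Submodule (Env k R) (Fin s → R)) (G : Set (Fin s → R)) : Prop where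
  finite : G.Finite
  subset : G ⊆ (M : Set (Fin s → R)) \ {0}
  span_eq : Submodule.span (Env k R) G = M
  expSet_eq : expSet B lt (M : Set (Fin s → R)) = expTranslates B lt G

end PBW

end

/-! Since `𝔪(a) = a • 1`, the map `h ↦ 𝔪^s(h')` on `(R ⊗ R^op)^{s+p}` is linear over `R ⊗ R^op`.
Condition (i) says that `h'H₁` depends only on `𝔪^s(h')`, so in a syzygy `(h', h'')` the block `h'`
may be replaced by any `g` with `𝔪^s(g) = 𝔪^s(h')` (`append_mem_syz`). With (ii), this makes `M` the
image of `Syz(H)` under that map (`eq_map_syz`), and part 1 follows by taking images of generators.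

For part 2, let `f ∈ M` have leading exponent `γ` in position `i`. Some syzygy has first block `f ⊗
1` (for `≺^*`, `≺^c`) or `1 ⊗ f` (for `≺_*`, `≺_c`). As POT ranks the first `s` positions highest,
its leading exponent is `(γ, 0)` or `(0, γ^op)` in position `i` (`isExp_append`). The exponent of
some `g` in the given basis divides it, hence has the same shape, with some `γ'` dividing `γ`. Every
exponent `(α, β)` below that of `g` satisfies `α + β^op ≺ γ'`, and `x^α x^{β^op}` has leading
exponent `α + β^op`. So no other term of `g` disturbs the leading term of `𝔪^s(g')`, whose exponent
is `γ'` (`isExp_mulEnvFst`). Generation then follows by division (`span_eq_of_expSet_subset`).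

The PBW input is that exponents of standard monomials add under multiplication (`hasLeading_mul`),
obtained by sorting words in the generators. -/

namespace PBW

/-! ### Leading exponents of products in a PBW algebra -/

section Words

variable {k R : Type*} [Field k] [Ring R] [Algebra k R] {n : ℕ}
  {m : MonomialOrder (Fin n)} {x : Fin n → R}

/-- The span of the standard monomials of exponent smaller than `γ`. -/
def lowerSpan (k : Type*) {R : Type*} [Field k] [Ring R] [Algebra k R] {n : ℕ}
    (m : MonomialOrder (Fin n)) (x : Fin n → R) (γ : Fin n →₀ ℕ) : Submodule k R :=
  Submodule.span k (stdMonomial x '' {α | α ≺[m] γ})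

theorem stdMonomial_mem_lowerSpan {α γ : Fin n →₀ ℕ} (h : α ≺[m] γ) :
    stdMonomial x α ∈ lowerSpan k m x γ :=
  Submodule.subset_span ⟨α, h, rfl⟩

theorem lowerSpan_mono {α γ : Fin n →₀ ℕ} (h : α ≺[m] γ) :
    lowerSpan k m x α ≤ lowerSpan k m x γ :=
  Submodule.span_mono (Set.image_mono fun _ hβ => lt_trans hβ h)

/-- `f` has leading exponent `γ`. -/
def HasLeading (k : Type*) {R : Type*} [Field k] [Ring R] [Algebra k R] {n : ℕ}
    (m : MonomialOrder (Fin n)) (x : Fin n → R) (f : R) (γ : Fin n →₀ ℕ) : Prop :=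
  ∃ c : k, c ≠ 0 ∧ f - c • stdMonomial x γ ∈ lowerSpan k m x γ

theorem HasLeading.mem_lowerSpan {f : R} {α γ : Fin n →₀ ℕ} (hf : HasLeading k m x f α)
    (h : α ≺[m] γ) : f ∈ lowerSpan k m x γ := by
  obtain ⟨c, -, hc⟩ := hf
  have := add_mem (lowerSpan_mono h hc)
    (Submodule.smul_mem _ c (stdMonomial_mem_lowerSpan (k := k) (x := x) h))
  simpa using this

theorem HasLeading.of_sub_smul {f g : R} {γ : Fin n →₀ ℕ} (hf : HasLeading k m x f γ)
    {c : k} (hc : c ≠ 0) (h : g - c • f ∈ lowerSpan k m x γ) : HasLeading k m x g γ := by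
  obtain ⟨d, hd, hfd⟩ := hf
  refine ⟨c * d, mul_ne_zero hc hd, ?_⟩
  have := add_mem h (Submodule.smul_mem _ c hfd)
  convert this using 1
  rw [smul_sub, mul_smul]
  abel

theorem hasLeading_stdMonomial (γ : Fin n →₀ ℕ) : HasLeading k m x (stdMonomial x γ) γ :=
  ⟨1, one_ne_zero, by simp⟩

theorem map_stdMonomial {A B F : Type*} [Monoid A] [Monoid B] [FunLike F A B]
    [MonoidHomClass F A B] (φ : F) (y : Fin n → A) (α : Fin n →₀ ℕ) :
    φ (stdMonomial y α) = stdMonomial (fun i => φ (y i)) α := by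
  rw [stdMonomial, stdMonomial, map_list_prod, List.map_ofFn]
  congr 2
  funext i
  simp

/-- The quantum relations lie in the kernel of the presentation. Only this inclusion is needed; that
they generate the kernel plays no role. -/
theorem IsPBWAlgebra.exists_commutation (hR : IsPBWAlgebra k m x) {i j : Fin n} (hij : i < j) :
    ∃ (q : k) (p : (Fin n →₀ ℕ) →₀ k), q ≠ 0 ∧
      (∀ α ∈ p.support, α ≺[m] Finsupp.single i 1 + Finsupp.single j 1) ∧
      x j * x i = q • (x i * x j) + p.sum fun α c => c • stdMonomial x α := by
  obtain ⟨q, p, hq, hp, hker⟩ := hR.exists_relations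
  refine ⟨q j i, p j i, hq i j hij, hp i j hij, ?_⟩
  have hmem : FreeAlgebra.ι k j * FreeAlgebra.ι k i - q j i • (FreeAlgebra.ι k i * FreeAlgebra.ι k j)
      - (p j i).sum (fun α c => c • stdMonomial (FreeAlgebra.ι k) α) ∈
      TwoSidedIdeal.ker (FreeAlgebra.lift k x) := by
    rw [hker]
    exact TwoSidedIdeal.subset_span ⟨i, j, hij, rfl⟩
  rw [TwoSidedIdeal.mem_ker] at hmem
  simp only [map_sub, map_mul, map_smul, FreeAlgebra.lift_ι_apply, Finsupp.sum, map_sum,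
    map_stdMonomial] at hmem
  rw [Finsupp.sum, ← sub_eq_iff_eq_add']
  exact sub_eq_zero.mp hmem

/-- The exponent vector of a word. -/
noncomputable def content (l : List (Fin n)) : Fin n →₀ ℕ := Multiset.toFinsupp (l : Multiset (Fin n))

theorem content_append (l l' : List (Fin n)) : content (l ++ l') = content l + content l' := by
  rw [content, ← Multiset.coe_add, map_add]
  rfl

theorem content_cons (i : Fin n) (l : List (Fin n)) :
    content (i :: l) = Finsupp.single i 1 + content l := by
  rw [content, ← Multiset.cons_coe, ← Multiset.singleton_add, map_add,
    Multiset.toFinsupp_singleton]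
  rfl

theorem content_eq_iff_perm {l l' : List (Fin n)} : content l = content l' ↔ l.Perm l' := by
  rw [content, content, EmbeddingLike.apply_eq_iff_eq, Multiset.coe_eq_coe]

/-- The sorted word of exponent vector `γ`. -/
def sortedWord (γ : Fin n →₀ ℕ) : List (Fin n) :=
  (List.ofFn fun i => List.replicate (γ i) i).flatten

theorem prod_map_sortedWord {A : Type*} [Monoid A] (y : Fin n → A) (γ : Fin n →₀ ℕ) :
    ((sortedWord γ).map y).prod = stdMonomial y γ := by
  rw [sortedWord, stdMonomial, List.map_flatten, List.prod_flatten, List.map_ofFn, List.map_ofFn]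
  congr 2
  funext i
  simp

theorem content_sortedWord (γ : Fin n →₀ ℕ) : content (sortedWord γ) = γ := by
  ext i
  rw [content, Multiset.toFinsupp_apply, Multiset.coe_count, sortedWord, List.count_flatten,
    List.map_ofFn, List.sum_ofFn]
  simp [List.count_replicate]

/-- Swapping two adjacent letters of a word changes it, up to a nonzero factor, by
smaller terms. -/
theorem IsPBWAlgebra.exists_swap (hR : IsPBWAlgebra k m x) {γ : Fin n →₀ ℕ}
    (ih : ∀ l : List (Fin n), content l ≺[m] γ → HasLeading k m x (l.map x).prod (content l))
    (u v : List (Fin n)) {i j : Fin n} (h : content (u ++ i :: j :: v) = γ) :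
    ∃ c : k, c ≠ 0 ∧ ((u ++ j :: i :: v).map x).prod - c • ((u ++ i :: j :: v).map x).prod ∈
      lowerSpan k m x γ := by
  have key : ∀ {i j : Fin n}, i < j → content (u ++ i :: j :: v) = γ →
      ∃ c : k, c ≠ 0 ∧ ((u ++ j :: i :: v).map x).prod - c • ((u ++ i :: j :: v).map x).prod ∈
      lowerSpan k m x γ := by
    intro i j hij h
    obtain ⟨q, p, hq, hp, hc⟩ := hR.exists_commutation hij
    refine ⟨q, hq, ?_⟩
    -- Only the tail `p` of the commutation rule survives. Its monomials are written as sorted words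
    -- so that the hypothesis on smaller words applies to them.
    have e : ((u ++ j :: i :: v).map x).prod - q • ((u ++ i :: j :: v).map x).prod =
        ∑ α ∈ p.support, p α • ((u ++ sortedWord α ++ v).map x).prod := by
      simp only [List.map_append, List.map_cons, List.prod_append, List.prod_cons,
        prod_map_sortedWord]
      rw [← mul_assoc (x j), hc, Finsupp.sum, add_mul, mul_add, smul_mul_assoc, mul_smul_comm,
        mul_assoc (x i), add_sub_cancel_left, Finset.sum_mul, Finset.mul_sum]
      simp [mul_assoc]
    rw [e]
    refine Submodule.sum_mem _ fun α hα => Submodule.smul_mem _ _ ?_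
    have hlt : content (u ++ sortedWord α ++ v) ≺[m] γ := by
      rw [← h]
      simp only [content_append, content_cons, content_sortedWord]
      have := hp α hα
      simp only [map_add] at this ⊢
      rw [add_assoc, ← add_assoc (m.toSyn (Finsupp.single i 1))]
      gcongr
    exact (ih _ hlt).mem_lowerSpan hlt
  rcases lt_trichotomy i j with hij | rfl | hij
  · exact key hij h
  · exact ⟨1, one_ne_zero, by simp⟩
  · have h' : content (u ++ j :: i :: v) = γ := by
      rw [← h, content_eq_iff_perm]
      exact (List.Perm.swap _ _ _).append_left u
    obtain ⟨c, hc, hm⟩ := key hij h'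
    -- For `j < i` the relation expresses the other word, and is solved for this one by dividing by
    -- `c`.
    refine ⟨c⁻¹, inv_ne_zero hc, ?_⟩
    have := Submodule.smul_mem _ (-c⁻¹) hm
    rw [smul_sub, smul_smul, neg_mul, inv_mul_cancel₀ hc] at this
    convert this using 1
    simp only [neg_smul, one_smul]
    abel

/-- A word in the generators of a PBW algebra is a nonzero multiple of the standard monomial with
the same exponents, up to smaller terms. -/
theorem IsPBWAlgebra.hasLeading_word (hR : IsPBWAlgebra k m x) (l : List (Fin n)) :
    HasLeading k m x (l.map x).prod (content l) := by
  suffices H : ∀ (a : m.syn) (l : List (Fin n)), m.toSyn (content l) = a →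
      HasLeading k m x (l.map x).prod (content l) from H _ l rfl
  intro a
  induction a using WellFoundedLT.induction with
  | ind a ih =>
    intro l hl
    subst hl
    have ih' : ∀ w : List (Fin n), content w ≺[m] content l →
        HasLeading k m x (w.map x).prod (content w) := fun w hw => ih _ hw w rfl
    -- The prefix `u` is universally quantified because the `cons` case of the permutation moves a
    -- letter into it.
    have perm : ∀ {l₁ l₂ : List (Fin n)}, l₁.Perm l₂ → ∀ u : List (Fin n),
        content (u ++ l₁) = content l →
        HasLeading k m x ((u ++ l₁).map x).prod (content l) →
        HasLeading k m x ((u ++ l₂).map x).prod (content l) := by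
      intro l₁ l₂ hp
      induction hp with
      | nil => exact fun u _ h => h
      | cons a _ ih =>
        intro u hu h
        have := ih (u ++ [a])
        simp only [List.append_assoc, List.singleton_append] at this
        exact this hu h
      | swap a b v =>
        intro u hu h
        obtain ⟨c, hc, hm⟩ := hR.exists_swap ih' u v hu
        exact h.of_sub_smul hc hm
      | trans hp₁ _ ih₁ ih₂ =>
        intro u hu h
        refine ih₂ u ?_ (ih₁ u hu h)
        rw [← hu, content_eq_iff_perm]
        exact (hp₁.append_left u).symm
    have := perm (content_eq_iff_perm.mp (content_sortedWord (content l))) []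
    simp only [List.nil_append, content_sortedWord, prod_map_sortedWord] at this
    exact this trivial (hasLeading_stdMonomial _)

/-- The product is the word obtained by concatenating the sorted words of `α` and `β`. -/
theorem IsPBWAlgebra.hasLeading_mul (hR : IsPBWAlgebra k m x) (α β : Fin n →₀ ℕ) :
    HasLeading k m x (stdMonomial x α * stdMonomial x β) (α + β) := by
  have := hR.hasLeading_word (sortedWord α ++ sortedWord β)
  simpa [content_append, content_sortedWord, prod_map_sortedWord] using this

theorem IsPBWAlgebra.hasLeading_stdMonomial_mul (hR : IsPBWAlgebra k m x) (δ : Fin n →₀ ℕ) {f : R}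
    {γ : Fin n →₀ ℕ} (hf : HasLeading k m x f γ) :
    HasLeading k m x (stdMonomial x δ * f) (δ + γ) := by
  have hle : lowerSpan k m x γ ≤
      (lowerSpan k m x (δ + γ)).comap (LinearMap.mulLeft k (stdMonomial x δ)) := by
    refine Submodule.span_le.mpr ?_
    rintro _ ⟨α, hα, rfl⟩
    refine (hR.hasLeading_mul δ α).mem_lowerSpan ?_
    have : m.toSyn α < m.toSyn γ := hα
    rw [map_add, map_add]
    gcongr
  obtain ⟨c, hc, hfc⟩ := hf
  refine (hR.hasLeading_mul δ γ).of_sub_smul hc ?_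
  simpa [mul_sub] using hle hfc

theorem IsPBWAlgebra.mem_lowerSpan_iff (hR : IsPBWAlgebra k m x) {f : R} {γ : Fin n →₀ ℕ} :
    f ∈ lowerSpan k m x γ ↔ ∀ α, hR.basis.repr f α ≠ 0 → α ≺[m] γ := by
  have : stdMonomial x = hR.basis := funext fun α => (hR.basis_apply α).symm
  rw [lowerSpan, this, Module.Basis.mem_span_image]
  simp [Set.subset_def]

theorem IsPBWAlgebra.hasLeading_iff (hR : IsPBWAlgebra k m x) {f : R} {γ : Fin n →₀ ℕ} :
    HasLeading k m x f γ ↔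
      hR.basis.repr f γ ≠ 0 ∧ ∀ α, hR.basis.repr f α ≠ 0 → α = γ ∨ α ≺[m] γ := by
  simp only [HasLeading, hR.mem_lowerSpan_iff, ← hR.basis_apply, map_sub, map_smul,
    Module.Basis.repr_self, Finsupp.sub_apply, Finsupp.smul_apply, Finsupp.single_apply,
    smul_eq_mul]
  constructor
  · rintro ⟨c, hc, h⟩
    have h0 : hR.basis.repr f γ = c := by
      by_contra hne
      have := h γ (by simpa [sub_eq_zero] using hne)
      exact lt_irrefl _ this
    refine ⟨h0 ▸ hc, fun α hα => or_iff_not_imp_left.mpr fun hne => h α ?_⟩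
    rwa [if_neg (Ne.symm hne), mul_zero, sub_zero]
  · rintro ⟨hc, h⟩
    refine ⟨_, hc, fun α hα => ?_⟩
    by_cases hne : α = γ
    · subst hne; simp at hα
    · rw [if_neg (Ne.symm hne), mul_zero, sub_zero] at hα
      exact (h α hα).resolve_left hne

end Words

/-! ### The multiplication map and `M` as an image of syzygies -/

section Env

variable {k R : Type*} [Field k] [Ring R] [Algebra k R]

/-- Evaluating the action at `1` is visibly linear over `R ⊗ R^op`, which gives the linearity of
`𝔪^s`. -/
theorem mulEnv_eq_smul_one (a : Env k R) : mulEnv k R a = a • (1 : R) := by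
  induction a using TensorProduct.induction_on with
  | zero => exact (map_zero _).trans (zero_smul (Env k R) (1 : R)).symm
  | tmul r r' =>
    obtain ⟨r', rfl⟩ := MulOpposite.op_surjective r'
    rw [mulEnv_tmul, env_tmul_smul, mul_one]
  | add a b ha hb => rw [map_add, ha, hb, add_smul]

theorem mulEnvPow_smul {s : ℕ} (a : Env k R) (h : Fin s → Env k R) :
    mulEnvPow (a • h) = a • mulEnvPow h := by
  funext i
  simp [mulEnvPow, mulEnv_eq_smul_one, mul_smul]

/-- The map `(R ⊗ R^op)^{s+p} → R^s`, `(h', h'') ↦ 𝔪^s(h')`. -/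
noncomputable def mulEnvFst (k R : Type*) [Field k] [Ring R] [Algebra k R] (s p : ℕ) :
    (Fin (s + p) → Env k R) →ₗ[Env k R] (Fin s → R) where
  toFun h := mulEnvPow fun i => h (Fin.castAdd p i)
  map_add' h h' := by funext i; simp [mulEnvPow]
  map_smul' a h := mulEnvPow_smul a _

theorem mulEnvPow_tmulOne {s : ℕ} (f : Fin s → R) : mulEnvPow (tmulOne k f) = f := by
  funext i
  simpa [mulEnvPow, tmulOne] using mulEnv_tmul (k := k) (f i) 1

theorem envVecMul_append {s p q : ℕ} (H₁ : Matrix (Fin s) (Fin q) R)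
    (H₂ : Matrix (Fin p) (Fin q) R) (h : Fin (s + p) → Env k R) :
    envVecMul k (Matrix.of (Fin.append H₁ H₂)) h =
      envVecMul k H₁ (fun i => h (Fin.castAdd p i)) +
        envVecMul k H₂ (fun i => h (Fin.natAdd s i)) := by
  simp only [envVecMul, LinearMap.coe_mk, AddHom.coe_mk, Fin.sum_univ_add]
  congr 1 <;> refine Finset.sum_congr rfl fun i _ => congrArg (h _ • ·) ?_
  · exact Fin.append_left H₁ H₂ i
  · exact Fin.append_right H₁ H₂ i

/-- Replacing `h'` by any `g` with the same image under `𝔪^s` keeps a syzygy a syzygy. -/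
theorem append_mem_syz {s p q : ℕ} {H₁ : Matrix (Fin s) (Fin q) R} {H₂ : Matrix (Fin p) (Fin q) R}
    (hi : ∀ h : Fin s → Env k R,
      envVecMul k H₁ (tmulOne k (mulEnvPow h)) = envVecMul k H₁ h)
    {h : Fin (s + p) → Env k R} (hh : h ∈ syz k (Matrix.of (Fin.append H₁ H₂)))
    {g : Fin s → Env k R} (hg : mulEnvPow g = mulEnvPow fun i => h (Fin.castAdd p i)) :
    Fin.append g (fun i => h (Fin.natAdd s i)) ∈ syz k (Matrix.of (Fin.append H₁ H₂)) := by
  rw [syz, LinearMap.mem_ker, envVecMul_append] at hh ⊢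
  simp only [Fin.append_left, Fin.append_right]
  rw [← hi g, hg, hi, hh]

/-- Condition (ii) asks for a first block of the form `f ⊗ 1`. By `append_mem_syz`, the first block
`h'` of any syzygy can be replaced by `𝔪^s(h') ⊗ 1`. -/
theorem eq_map_syz {s p q : ℕ} {H₁ : Matrix (Fin s) (Fin q) R} {H₂ : Matrix (Fin p) (Fin q) R}
    (hi : ∀ h : Fin s → Env k R,
      envVecMul k H₁ (tmulOne k (mulEnvPow h)) = envVecMul k H₁ h)
    {M : Submodule (Env k R) (Fin s → R)}
    (hM : (M : Set (Fin s → R)) = {h | ∃ h'' : Fin p → Env k R,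
      Fin.append (tmulOne k h) h'' ∈ syz k (Matrix.of (Fin.append H₁ H₂))}) :
    M = (syz k (Matrix.of (Fin.append H₁ H₂))).map (mulEnvFst k R s p) := by
  ext f
  rw [← SetLike.mem_coe, hM]
  constructor
  · rintro ⟨h'', hh⟩
    refine ⟨_, hh, ?_⟩
    simp [mulEnvFst, mulEnvPow_tmulOne]
  · rintro ⟨h, hh, rfl⟩
    exact ⟨_, append_mem_syz hi hh (mulEnvPow_tmulOne _)⟩

end Env

/-! ### Leading exponents and division in `R^s` -/

section Groebner

variable {k R : Type*} [Field k] [Ring R] [Algebra k R] {n : ℕ}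
  {m : MonomialOrder (Fin n)} {x : Fin n → R} {s : ℕ}

/-- POT is lexicographic: first the reversed order on finitely many positions, then the well-order
`≺`. -/
theorem wellFounded_pot (m : MonomialOrder (Fin n)) (s : ℕ) :
    WellFounded (pot (s := s) fun α β => α ≺[m] β) := by
  have hw : WellFounded (Prod.Lex (fun i j : Fin s => j < i) fun a b : m.syn => a < b) :=
    WellFounded.prod_lex wellFounded_gt wellFounded_lt
  refine Subrelation.wf ?_ (InvImage.wf (fun e : (Fin n →₀ ℕ) × Fin s => (e.2, m.toSyn e.1)) hw)
  rintro ⟨α, i⟩ ⟨β, j⟩ h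
  exact Prod.lex_def.mpr h

/-- The first position is the largest, so the leading term sits in the first nonzero component. -/
theorem IsPBWAlgebra.isExp_iff (hR : IsPBWAlgebra k m x) {f : Fin s → R}
    {e : (Fin n →₀ ℕ) × Fin s} :
    IsExp hR.basis (pot fun α β => α ≺[m] β) f e ↔
      (∀ j < e.2, f j = 0) ∧ HasLeading k m x (f e.2) e.1 := by
  rw [hR.hasLeading_iff]
  constructor
  · rintro ⟨h0, h⟩
    refine ⟨fun j hj => ?_, h0, fun α hα => ?_⟩
    · by_contra hne
      obtain ⟨α, hα⟩ := Finsupp.ne_iff.mp (hR.basis.repr.map_ne_zero_iff.mpr hne)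
      rcases h (α, j) hα with he | he | he
      · exact hj.ne (congrArg Prod.snd he)
      · exact lt_asymm hj he
      · exact hj.ne he.1
    · rcases h (α, e.2) hα with he | he | he
      · exact Or.inl (congrArg Prod.fst he)
      · exact absurd he (lt_irrefl _)
      · exact Or.inr he.2
  · rintro ⟨hz, h0, h⟩
    refine ⟨h0, ?_⟩
    rintro ⟨α, j⟩ hα
    rcases lt_trichotomy j e.2 with hj | rfl | hj
    · simp [hz j hj] at hα
    · rcases h α hα with rfl | he
      · exact Or.inl rfl
      · exact Or.inr (Or.inr ⟨rfl, he⟩)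
    · exact Or.inr (Or.inl hj)

theorem IsPBWAlgebra.exists_isExp (hR : IsPBWAlgebra k m x) {f : Fin s → R} (hf : f ≠ 0) :
    ∃ e, IsExp hR.basis (pot fun α β => α ≺[m] β) f e := by
  obtain ⟨i, hi, hmin⟩ := WellFounded.has_min (wellFounded_lt (α := Fin s)) {i | f i ≠ 0}
    (Function.ne_iff.mp hf)
  obtain ⟨γ, hγ, hmax⟩ := Finset.exists_max_image (hR.basis.repr (f i)).support m.toSyn
    (Finsupp.support_nonempty_iff.mpr (hR.basis.repr.map_ne_zero_iff.mpr hi))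
  refine ⟨(γ, i), hR.isExp_iff.mpr ⟨fun j hj => not_not.mp fun h => hmin j h hj,
    hR.hasLeading_iff.mpr ⟨Finsupp.mem_support_iff.mp hγ, fun α hα => ?_⟩⟩⟩
  rcases (hmax α (Finsupp.mem_support_iff.mpr hα)).eq_or_lt with h | h
  · exact Or.inl (m.toSyn.injective h)
  · exact Or.inr h

theorem IsPBWAlgebra.isExp_stdMonomial_smul (hR : IsPBWAlgebra k m x) (δ : Fin n →₀ ℕ)
    {g : Fin s → R} {d : (Fin n →₀ ℕ) × Fin s}
    (hg : IsExp hR.basis (pot fun α β => α ≺[m] β) g d) :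
    IsExp hR.basis (pot fun α β => α ≺[m] β)
      ((stdMonomial x δ ⊗ₜ[k] MulOpposite.op 1 : Env k R) • g) (δ + d.1, d.2) := by
  rw [hR.isExp_iff] at hg ⊢
  refine ⟨fun j hj => by simp [hg.1 j hj], ?_⟩
  rw [Pi.smul_apply, env_tmul_smul, mul_one]
  exact hR.hasLeading_stdMonomial_mul δ hg.2

theorem smul_fun_eq_algebraMap_smul (c : k) (f : Fin s → R) :
    c • f = (algebraMap k R c ⊗ₜ[k] MulOpposite.op 1 : Env k R) • f := by
  funext i
  rw [Pi.smul_apply, Pi.smul_apply, env_tmul_smul, mul_one, Algebra.smul_def]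

/-- Division: a subset of `M` with the right leading exponents generates `M`. -/
theorem IsPBWAlgebra.span_eq_of_expSet_subset (hR : IsPBWAlgebra k m x)
    {M : Submodule (Env k R) (Fin s → R)} {G : Set (Fin s → R)} (hG : G ⊆ M)
    (h : expSet hR.basis (pot fun α β => α ≺[m] β) (M : Set (Fin s → R)) ⊆
      expTranslates hR.basis (pot fun α β => α ≺[m] β) G) :
    Submodule.span (Env k R) G = M := by
  have hle : Submodule.span (Env k R) G ≤ M := Submodule.span_le.mpr hG
  refine le_antisymm hle ?_
  suffices H : ∀ e, ∀ f ∈ M, IsExp hR.basis (pot fun α β => α ≺[m] β) f e →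
      f ∈ Submodule.span (Env k R) G by
    intro f hf
    by_cases h0 : f = 0
    · subst h0; exact zero_mem _
    · obtain ⟨e, he⟩ := hR.exists_isExp h0
      exact H e f hf he
  intro e
  induction e using (wellFounded_pot m s).induction with
  | _ e ih =>
  intro f hf he
  obtain ⟨g, hgG, d, hd, δ, rfl⟩ := h ⟨f, hf, he⟩
  have hexp := hR.isExp_stdMonomial_smul δ hd
  set w : Fin s → R := (stdMonomial x δ ⊗ₜ[k] MulOpposite.op 1 : Env k R) • g with hw
  have hwG : w ∈ Submodule.span (Env k R) G :=
    Submodule.smul_mem _ _ (Submodule.subset_span hgG)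
  -- This quotient of leading coefficients cancels the leading term of `f` in `f - c • w`.
  set c : k := hR.basis.repr (f d.2) (δ + d.1) / hR.basis.repr (w d.2) (δ + d.1) with hc
  have hcw : c • w ∈ Submodule.span (Env k R) G := by
    rw [smul_fun_eq_algebraMap_smul]
    exact Submodule.smul_mem _ _ hwG
  suffices hr : f - c • w ∈ Submodule.span (Env k R) G by simpa using add_mem hr hcw
  have hrM : f - c • w ∈ M := sub_mem hf (hle hcw)
  by_cases h0 : f - c • w = 0
  · rw [h0]; exact zero_mem _
  obtain ⟨e', he'⟩ := hR.exists_isExp h0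
  refine ih e' ?_ _ hrM he'
  have hne : hR.basis.repr (f e'.2) e'.1 - c * hR.basis.repr (w e'.2) e'.1 ≠ 0 := by
    simpa using he'.1
  -- An exponent of `f - c • w` occurs in `f` or in `w`, and these two share their leading exponent.
  have hlt : e' = (δ + d.1, d.2) ∨ pot (fun α β => α ≺[m] β) e' (δ + d.1, d.2) := by
    by_cases hfe : hR.basis.repr (f e'.2) e'.1 = 0
    · refine hexp.2 e' fun hwe => hne ?_
      rw [hfe, hwe, mul_zero, sub_zero]
    · exact he.2 e' hfe
  refine hlt.resolve_left ?_
  rintro rfl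
  exact hne (by rw [hc, div_mul_cancel₀ _ hexp.1, sub_self])

end Groebner

/-! ### Leading exponents under `𝔪^s` and under the embeddings of `R` -/

section Lift

variable {k R : Type*} [Field k] [Ring R] [Algebra k R] {n : ℕ}
  {m : MonomialOrder (Fin n)} {x : Fin n → R} {s p : ℕ}

/-- If the leading term of `h` is that of `x^γ`, placed on one of the two sides of `R ⊗ R^op`, and
the other terms of `h` have smaller total degree, then `𝔪^s(h')` has leading exponent `γ`. -/
theorem IsPBWAlgebra.isExp_mulEnvFst (hR : IsPBWAlgebra k m x)
    {lt : (Fin n →₀ ℕ) × (Fin n →₀ ℕ) → (Fin n →₀ ℕ) × (Fin n →₀ ℕ) → Prop}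
    {h : Fin (s + p) → Env k R} {a : (Fin n →₀ ℕ) × (Fin n →₀ ℕ)} {i : Fin s}
    (hlt : ∀ b, lt b a → b.1 + opExp b.2 ≺[m] a.1 + opExp a.2)
    (ha : HasLeading k m x (mulEnv k R (hR.envBasis a)) (a.1 + opExp a.2))
    (hh : IsExp hR.envBasis (pot lt) h (a, Fin.castAdd p i)) :
    IsExp hR.basis (pot fun α β => α ≺[m] β) (mulEnvFst k R s p h) (a.1 + opExp a.2, i) := by
  rw [hR.isExp_iff]
  obtain ⟨h0, hle⟩ := hh
  refine ⟨fun j hj => ?_, ?_⟩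
  · have hz : h (Fin.castAdd p j) = 0 := by
      by_contra hne
      obtain ⟨b, hb⟩ := Finsupp.ne_iff.mp (hR.envBasis.repr.map_ne_zero_iff.mpr hne)
      have hj' : Fin.castAdd p j < Fin.castAdd p i := hj
      rcases hle (b, Fin.castAdd p j) hb with he | he | he
      · exact hj'.ne (congrArg Prod.snd he)
      · exact lt_asymm hj' he
      · exact hj'.ne he.1
    simp [mulEnvFst, mulEnvPow, hz]
  · refine ha.of_sub_smul h0 ?_
    have hsum : mulEnvFst k R s p h i = ∑ b ∈ (hR.envBasis.repr (h (Fin.castAdd p i))).support,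
        hR.envBasis.repr (h (Fin.castAdd p i)) b • mulEnv k R (hR.envBasis b) := by
      conv_lhs => rw [mulEnvFst, LinearMap.coe_mk, AddHom.coe_mk, mulEnvPow,
        ← hR.envBasis.linearCombination_repr (h (Fin.castAdd p i)),
        Finsupp.linearCombination_apply, Finsupp.sum, map_sum]
      simp
    rw [hsum, ← Finset.add_sum_erase _ _ (Finsupp.mem_support_iff.mpr h0), add_sub_cancel_left]
    refine Submodule.sum_mem _ fun b hb => Submodule.smul_mem _ _ ?_
    obtain ⟨hba, hb⟩ := Finset.mem_erase.mp hb
    rw [Finsupp.mem_support_iff] at hb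
    have hlt' : lt b a := by
      rcases hle (b, Fin.castAdd p i) hb with he | he | he
      · exact absurd (congrArg Prod.fst he) hba
      · exact absurd he (lt_irrefl _)
      · exact he.2
    rw [hR.envBasis_apply, mulEnv_tmul]
    exact (hR.hasLeading_mul _ _).mem_lowerSpan (hlt b hlt')

/-- An embedding of `R` into `R ⊗ R^op`, sending `x^γ` to the standard monomial of exponent `ι γ`,
carries leading exponents to leading exponents. -/
theorem IsPBWAlgebra.isExp_append (hR : IsPBWAlgebra k m x)
    {lt : (Fin n →₀ ℕ) × (Fin n →₀ ℕ) → (Fin n →₀ ℕ) × (Fin n →₀ ℕ) → Prop}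
    {ι : (Fin n →₀ ℕ) → (Fin n →₀ ℕ) × (Fin n →₀ ℕ)} (hι : Function.Injective ι)
    {φ : R →ₗ[k] Env k R} (hφ : ∀ γ, φ (hR.basis γ) = hR.envBasis (ι γ))
    (hlt : ∀ α β, α ≺[m] β → lt (ι α) (ι β))
    {f : Fin s → R} {e : (Fin n →₀ ℕ) × Fin s}
    (hf : IsExp hR.basis (pot fun α β => α ≺[m] β) f e) (h'' : Fin p → Env k R) :
    IsExp hR.envBasis (pot lt) (Fin.append (fun i => φ (f i)) h'')
      (ι e.1, Fin.castAdd p e.2) := by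
  -- Coordinates are transported along `ι`, so the exponents of `φ r` are the `ι α` with `α` an
  -- exponent of `r`.
  have hrepr : ∀ r : R, hR.envBasis.repr (φ r) = (hR.basis.repr r).mapDomain ι := by
    have : hR.envBasis.repr.toLinearMap ∘ₗ φ =
        Finsupp.lmapDomain k k ι ∘ₗ hR.basis.repr.toLinearMap :=
      hR.basis.ext fun γ => by simp [hφ, Finsupp.mapDomain_single]
    exact fun r => LinearMap.congr_fun this r
  refine ⟨?_, ?_⟩
  · simp only [Fin.append_left, hrepr, Finsupp.mapDomain_apply hι]
    exact hf.1
  · rintro ⟨b, j⟩ hb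
    induction j using Fin.addCases with
    | right j =>
      -- The last `p` positions are lower in POT, so `h''` cannot affect the leading term.
      refine Or.inr (Or.inl ?_)
      change Fin.castAdd p e.2 < Fin.natAdd s j
      simp only [Fin.lt_def, Fin.val_castAdd, Fin.val_natAdd]
      omega
    | left j =>
      simp only [Fin.append_left, hrepr] at hb
      obtain ⟨α, rfl⟩ : b ∈ Set.range ι := by
        by_contra hne
        exact hb (Finsupp.mapDomain_of_notMem_range _ _ hne)
      rw [Finsupp.mapDomain_apply hι] at hb
      rcases hf.2 (α, j) hb with rfl | he | ⟨he, he'⟩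
      · exact Or.inl rfl
      · exact Or.inr (Or.inl he)
      · exact Or.inr (Or.inr ⟨congrArg (Fin.castAdd p) he, hlt _ _ he'⟩)

/-- The two-sided Gröbner basis of `𝔪^s(N)` obtained from a left Gröbner basis of `N`, for an order
for which `ι` embeds the exponents of `R` as those of an elimination part of `R ⊗ R^op`. -/
theorem IsPBWAlgebra.isTwoSidedGroebnerBasis_of_embedding (hR : IsPBWAlgebra k m x)
    {lt : (Fin n →₀ ℕ) × (Fin n →₀ ℕ) → (Fin n →₀ ℕ) × (Fin n →₀ ℕ) → Prop}
    {ι : (Fin n →₀ ℕ) → (Fin n →₀ ℕ) × (Fin n →₀ ℕ)}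
    (hsum : ∀ γ, (ι γ).1 + opExp (ι γ).2 = γ)
    (hadd : ∀ γ a b, ι γ = a + b → ∃ γ', b = ι γ')
    {φ : R →ₗ[k] Env k R} (hφ : ∀ γ, φ (hR.basis γ) = hR.envBasis (ι γ))
    (hφm : ∀ r, mulEnv k R (φ r) = r)
    (hlt : ∀ α β, α ≺[m] β → lt (ι α) (ι β))
    (hlt' : ∀ γ b, lt b (ι γ) → b.1 + opExp b.2 ≺[m] γ)
    {N : Submodule (Env k R) (Fin (s + p) → Env k R)}
    (hN : ∀ h ∈ N, ∀ g : Fin s → Env k R, mulEnvPow g = mulEnvFst k R s p h →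
      Fin.append g (fun i => h (Fin.natAdd s i)) ∈ N)
    {G : Set (Fin (s + p) → Env k R)} (hG : IsLeftGroebnerBasis hR.envBasis (pot lt) N G) :
    IsTwoSidedGroebnerBasis hR.basis (pot fun α β => α ≺[m] β) (N.map (mulEnvFst k R s p))
      (mulEnvFst k R s p '' G \ {0}) := by
  have hι : Function.Injective ι := fun α β h => by rw [← hsum α, h, hsum]
  have hsub : mulEnvFst k R s p '' G \ {0} ⊆
      (N.map (mulEnvFst k R s p) : Set (Fin s → R)) \ {0} := by
    rintro _ ⟨⟨g, hg, rfl⟩, hne⟩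
    exact ⟨⟨g, (hG.subset hg).1, rfl⟩, hne⟩
  have hexp : expSet hR.basis (pot fun α β => α ≺[m] β)
      (N.map (mulEnvFst k R s p) : Set (Fin s → R)) ⊆
      expTranslates hR.basis (pot fun α β => α ≺[m] β) (mulEnvFst k R s p '' G \ {0}) := by
    rintro e ⟨_, ⟨h, hh, rfl⟩, he⟩
    -- The first block of `h` is exchanged for the lift by `φ` of its image, whose leading exponent
    -- is known.
    have hmem := hN h hh (fun i => φ (mulEnvFst k R s p h i))
      (funext fun i => hφm _)
    have hE : (ι e.1, Fin.castAdd p e.2) ∈ expSet hR.envBasis (pot lt)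
        (N : Set (Fin (s + p) → Env k R)) := ⟨_, hmem, hR.isExp_append hι hφ hlt he _⟩
    rw [hG.expSet_eq] at hE
    obtain ⟨g, hg, ⟨d, j⟩, hd, δ, hδ⟩ := hE
    obtain ⟨h1, h2⟩ := Prod.ext_iff.mp hδ
    simp only at h1 h2
    subst h2
    obtain ⟨γ, rfl⟩ := hadd _ _ _ h1
    have hlead : HasLeading k m x (mulEnv k R (hR.envBasis (ι γ)))
        ((ι γ).1 + opExp (ι γ).2) := by
      rw [← hφ, hφm, hsum, hR.basis_apply]
      exact hasLeading_stdMonomial γ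
    have hg' := hR.isExp_mulEnvFst (fun b hb => (hsum γ).symm ▸ hlt' γ b hb) hlead hd
    rw [hsum] at hg'
    -- The map `(α, β) ↦ α + β^op` is additive and inverts `ι` on its range; applied to `ι e.1 = δ +
    -- ι γ` it gives this cofactor.
    refine ⟨_, ⟨⟨g, hg, rfl⟩, ?_⟩, _, hg', δ.1 + opExp δ.2, ?_⟩
    · intro h0
      have := hg'.1
      rw [Set.mem_singleton_iff.mp h0] at this
      simp at this
    · have hopadd : ∀ a b : Fin n →₀ ℕ, opExp (a + b) = opExp a + opExp b := fun a b => by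
        ext i; simp [opExp_apply]
      ext1
      · have := congrArg (fun a : (Fin n →₀ ℕ) × (Fin n →₀ ℕ) => a.1 + opExp a.2) h1
        simp only [hsum, Prod.fst_add, Prod.snd_add, hopadd] at this
        rw [this, add_add_add_comm, hsum]
      · rfl
  refine ⟨(hG.finite.image _).subset Set.sdiff_subset, hsub,
    hR.span_eq_of_expSet_subset (hsub.trans Set.sdiff_subset) hexp, hexp.antisymm ?_⟩
  -- Conversely, `γ + exp(g)` is the leading exponent of `x^γ g`, which lies in the image.
  rintro _ ⟨g, hg, d, hd, γ, rfl⟩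
  exact ⟨_, Submodule.smul_mem _ _ (hsub hg).1, hR.isExp_stdMonomial_smul γ hd⟩

end Lift

/-! ### The four orders on `ℕ^{2n}` -/

section Orders

variable {k R : Type*} [Field k] [Ring R] [Algebra k R] {n : ℕ}
  {m : MonomialOrder (Fin n)} {x : Fin n → R} {s p : ℕ}

theorem opExp_zero : opExp (0 : Fin n →₀ ℕ) = 0 := by
  ext i; simp [opExp_apply]

theorem opExp_opExp (α : Fin n →₀ ℕ) : opExp (opExp α) = α := by
  ext i; simp [opExp_apply]

theorem not_lt_zero_toSyn (α : Fin n →₀ ℕ) : ¬ α ≺[m] 0 := by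
  rw [map_zero]
  exact m.zero_le _ |>.not_gt

theorem stdMonomial_zero {A : Type*} [Monoid A] (y : Fin n → A) : stdMonomial y 0 = 1 := by
  simp [stdMonomial]

/-- For the orders `≺^*` and `≺^c`, a left Gröbner basis of `N` gives a two-sided one of its image,
through the embedding `f ↦ f ⊗ 1`. -/
theorem IsPBWAlgebra.isTwoSidedGroebnerBasis_up (hR : IsPBWAlgebra k m x)
    {lt : (Fin n →₀ ℕ) × (Fin n →₀ ℕ) → (Fin n →₀ ℕ) × (Fin n →₀ ℕ) → Prop}
    (hlt : lt = elimUp m ∨ lt = compUp m)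
    {N : Submodule (Env k R) (Fin (s + p) → Env k R)}
    (hN : ∀ h ∈ N, ∀ g : Fin s → Env k R, mulEnvPow g = mulEnvFst k R s p h →
      Fin.append g (fun i => h (Fin.natAdd s i)) ∈ N)
    {G : Set (Fin (s + p) → Env k R)} (hG : IsLeftGroebnerBasis hR.envBasis (pot lt) N G) :
    IsTwoSidedGroebnerBasis hR.basis (pot fun α β => α ≺[m] β) (N.map (mulEnvFst k R s p))
      (mulEnvFst k R s p '' G \ {0}) := by
  refine hR.isTwoSidedGroebnerBasis_of_embedding (ι := fun γ => (γ, 0))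
    (φ := (Algebra.TensorProduct.includeLeft : R →ₐ[k] Env k R).toLinearMap)
    (fun γ => by simp [opExp_zero]) ?_ ?_ (fun r => ?_) ?_ ?_ hN hG
  -- A summand of a zero exponent is zero, so divisors of `(γ, 0)` keep that shape.
  · rintro γ ⟨a₁, a₂⟩ ⟨b₁, b₂⟩ h
    have h2 : 0 = a₂ + b₂ := congrArg Prod.snd h
    exact ⟨b₁, by rw [(add_eq_zero.mp h2.symm).2]⟩
  · intro γ
    simp [hR.envBasis_apply, hR.basis_apply, opExp_zero, stdMonomial_zero]
  · simpa using mulEnv_tmul (k := k) r 1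
  · rintro α β h
    rcases hlt with rfl | rfl
    · exact Or.inr ⟨rfl, h⟩
    · exact Or.inl (by simpa [opExp_zero] using h)
  · rintro γ ⟨b₁, b₂⟩ h
    rcases hlt with rfl | rfl
    -- Nothing lies below the exponent `0`, so for `≺^*` an exponent below `(γ, 0)` has second
    -- component `0`.
    · rcases h with h | ⟨h, h'⟩
      · simp only [opLT, opExp_zero] at h
        exact absurd h (not_lt_zero_toSyn _)
      · simp only at h
        subst h
        simpa [opExp_zero] using h'
    -- For `≺^c` a tie of the sums would need a second component below `0`, so the sum drops
    -- strictly.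
    · rcases h with h | ⟨-, h⟩
      · simpa [opExp_zero] using h
      · simp only [opExp_zero] at h
        exact absurd h (not_lt_zero_toSyn _)

/-- For the orders `≺_*` and `≺_c`, a left Gröbner basis of `N` gives a two-sided one of its image,
through the embedding `f ↦ 1 ⊗ f`. -/
theorem IsPBWAlgebra.isTwoSidedGroebnerBasis_down (hR : IsPBWAlgebra k m x)
    {lt : (Fin n →₀ ℕ) × (Fin n →₀ ℕ) → (Fin n →₀ ℕ) × (Fin n →₀ ℕ) → Prop}
    (hlt : lt = elimDown m ∨ lt = compDown m)
    {N : Submodule (Env k R) (Fin (s + p) → Env k R)}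
    (hN : ∀ h ∈ N, ∀ g : Fin s → Env k R, mulEnvPow g = mulEnvFst k R s p h →
      Fin.append g (fun i => h (Fin.natAdd s i)) ∈ N)
    {G : Set (Fin (s + p) → Env k R)} (hG : IsLeftGroebnerBasis hR.envBasis (pot lt) N G) :
    IsTwoSidedGroebnerBasis hR.basis (pot fun α β => α ≺[m] β) (N.map (mulEnvFst k R s p))
      (mulEnvFst k R s p '' G \ {0}) := by
  refine hR.isTwoSidedGroebnerBasis_of_embedding (ι := fun γ => (0, opExp γ))
    (φ := (Algebra.TensorProduct.includeRight : Rᵐᵒᵖ →ₐ[k] Env k R).toLinearMap ∘ₗ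
      (MulOpposite.opLinearEquiv k).toLinearMap)
    (fun γ => by simp [opExp_opExp]) ?_ ?_ (fun r => ?_) ?_ ?_ hN hG
  · rintro γ ⟨a₁, a₂⟩ ⟨b₁, b₂⟩ h
    have h1 : 0 = a₁ + b₁ := congrArg Prod.fst h
    exact ⟨opExp b₂, by rw [(add_eq_zero.mp h1.symm).2, opExp_opExp]⟩
  · intro γ
    simp [hR.envBasis_apply, hR.basis_apply, opExp_opExp, stdMonomial_zero]
  · simpa using mulEnv_tmul (k := k) 1 r
  · rintro α β h
    rcases hlt with rfl | rfl
    · exact Or.inr ⟨rfl, by simpa [opLT, opExp_opExp] using h⟩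
    · exact Or.inl (by simpa [opExp_opExp] using h)
  · rintro γ ⟨b₁, b₂⟩ h
    -- The same argument with the roles of the components exchanged: the first component of `(0,
    -- γ^op)` is already minimal.
    rcases hlt with rfl | rfl
    · rcases h with h | ⟨h, h'⟩
      · exact absurd h (not_lt_zero_toSyn _)
      · simp only at h
        subst h
        simpa [opLT, opExp_opExp] using h'
    · rcases h with h | ⟨-, h⟩
      · simpa [opExp_opExp] using h
      · exact absurd h (not_lt_zero_toSyn _)

end Orders

end PBW

/-! ### Generators and Gröbner bases of `M` from those of the syzygy bimodule -/

theorem mainTheorem6 {k R : Type*} [Field k] [Ring R] [Algebra k R] {n : ℕ}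
    (m : MonomialOrder (Fin n)) (x : Fin n → R) (hR : PBW.IsPBWAlgebra k m x)
    {s p q : ℕ} (hs : 1 ≤ s) (hp : 1 ≤ p) (hq : 1 ≤ q)
    (M : Submodule (PBW.Env k R) (Fin s → R))
    (H₁ : Matrix (Fin s) (Fin q) R) (H₂ : Matrix (Fin p) (Fin q) R)
    (H : Matrix (Fin (s + p)) (Fin q) R) (hH : H = Matrix.of (Fin.append H₁ H₂))
    (hi : ∀ h : Fin s → PBW.Env k R,
      PBW.envVecMul k H₁ (PBW.tmulOne k (PBW.mulEnvPow h)) = PBW.envVecMul k H₁ h)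
    (hii : (M : Set (Fin s → R)) = {h | ∃ h'' : Fin p → PBW.Env k R,
      Fin.append (PBW.tmulOne k h) h'' ∈ PBW.syz k H})
    {t : ℕ} (h : Fin t → Fin (s + p) → PBW.Env k R) :
    (Submodule.span (PBW.Env k R) (Set.range h) = PBW.syz k H →
      M = Submodule.span (PBW.Env k R)
        (Set.range fun l => PBW.mulEnvPow fun i => h l (Fin.castAdd p i))) ∧
    (∀ lt ∈ ({PBW.elimUp m, PBW.compUp m, PBW.elimDown m, PBW.compDown m} :
        Set ((Fin n →₀ ℕ) × (Fin n →₀ ℕ) → (Fin n →₀ ℕ) × (Fin n →₀ ℕ) → Prop)),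
      PBW.IsLeftGroebnerBasis hR.envBasis (PBW.pot lt) (PBW.syz k H) (Set.range h) →
      PBW.IsTwoSidedGroebnerBasis hR.basis (PBW.pot fun α β => α ≺[m] β) M
        ((Set.range fun l => PBW.mulEnvPow fun i => h l (Fin.castAdd p i)) \ {0})) := by
  subst hH
  have hM := PBW.eq_map_syz hi hii
  have hrange : (Set.range fun l => PBW.mulEnvPow fun i => h l (Fin.castAdd p i)) =
      PBW.mulEnvFst k R s p '' Set.range h := Set.range_comp (PBW.mulEnvFst k R s p) h
  rw [hrange, hM]
  refine ⟨fun hspan => ?_, fun lt hlt hG => ?_⟩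
  · rw [← hspan, Submodule.map_span]
  · have hN : ∀ g ∈ PBW.syz k (Matrix.of (Fin.append H₁ H₂)), ∀ g' : Fin s → PBW.Env k R,
        PBW.mulEnvPow g' = PBW.mulEnvFst k R s p g →
        Fin.append g' (fun i => g (Fin.natAdd s i)) ∈
          PBW.syz k (Matrix.of (Fin.append H₁ H₂)) :=
      fun g hg g' hg' => PBW.append_mem_syz hi hg hg'
    rcases hlt with hlt | hlt | hlt | hlt
    · exact hR.isTwoSidedGroebnerBasis_up (Or.inl hlt) hN hG
    · exact hR.isTwoSidedGroebnerBasis_up (Or.inr hlt) hN hG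
    · exact hR.isTwoSidedGroebnerBasis_down (Or.inl hlt) hN hG
    · exact hR.isTwoSidedGroebnerBasis_down (Or.inr hlt) hN hG
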